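/- Let $d \ge 3$ be an integer, and let $\mathbb{H}^d = \{(z,x) : z > 0,\ x \in \mathbb{R}^{d-1}\}$ be $d$-dimensional hyperbolic space in the upper half-space model, with the distance $$d_{\mathbb{H}}\big((z_1,x_1),(z_2,x_2)\big) = \operatorname{arccosh}\Big(1 + \frac{\|x_1-x_2\|^2 + (z_1-z_2)^2}{2 z_1 z_2}\Big).$$ For all real numbers $r > 0$ and $c > 1$ there exist a countable set $U$, a family $\mathcal{H}$ of hash functions $h : \mathbb{H}^d \to U$ equipped with a probability distribution, and real numbers $0 < p_2 < p_1 < 1$ such that $\mathcal{H}$ is $(r, cr, p_1, p_2)$-sensitive, that is, for all $x, y \in \mathbb{H}^d$, $$d_{\mathbb{H}}(x,y) \le r \implies \Pr_{h \sim \mathcal{H}}[h(x) = h(y)] \ge p_1, \qquad d_{\mathbb{H}}(x,y) \ge cr \implies \Pr_{h \sim \mathcal{H}}[h(x) = h(y)] \le p_2,$$ and such that $$\rho(\mathcal{H}) = \frac{\log(1/p_1)}{\log(1/p_2)} \le \frac{1.59}{c}.$$ -/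

import Mathlib

open MeasureTheory

noncomputable section

/-- The upper half-space model of `d`-dimensional hyperbolic space (`d ≥ 1`): a point is a pair
`(z, x)` of a positive height `z` and a horizontal coordinate `x ∈ ℝ^(d-1)`. -/
@[ext] structure HyperbolicSpace (d : ℕ) where
  /-- the height `z` -/
  height : ℝ
  /-- the horizontal coordinate `x` -/
  horiz : EuclideanSpace ℝ (Fin (d - 1))
  /-- the height is positive -/
  height_pos : 0 < height

namespace HyperbolicSpace

variable {d : ℕ}

/-- The hyperbolic distance
`arcosh (1 + (‖x₁ - x₂‖² + (z₁ - z₂)²) / (2 z₁ z₂))` (curvature `-1`). -/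
instance : Dist (HyperbolicSpace d) where
  dist p q := Real.arcosh
    (1 + (‖p.horiz - q.horiz‖ ^ 2 + (p.height - q.height) ^ 2) / (2 * p.height * q.height))

theorem dist_def (p q : HyperbolicSpace d) : dist p q = Real.arcosh
    (1 + (‖p.horiz - q.horiz‖ ^ 2 + (p.height - q.height) ^ 2) / (2 * p.height * q.height)) :=
  rfl

theorem frac_nonneg (p q : HyperbolicSpace d) :
    0 ≤ (‖p.horiz - q.horiz‖ ^ 2 + (p.height - q.height) ^ 2) / (2 * p.height * q.height) := by
  have h₁ := p.height_pos
  have h₂ := q.height_pos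
  positivity

/-- Distances in the upper half-plane, in terms of coordinates. -/
theorem upperHalfPlane_dist (a b s t : ℝ) (hs : 0 < s) (ht : 0 < t) :
    dist (UpperHalfPlane.mk ⟨a, s⟩ hs) (UpperHalfPlane.mk ⟨b, t⟩ ht) =
      Real.arcosh (1 + ((a - b) ^ 2 + (s - t) ^ 2) / (2 * s * t)) := by
  rw [← Real.arcosh_cosh (x := dist (UpperHalfPlane.mk ⟨a, s⟩ hs) (UpperHalfPlane.mk ⟨b, t⟩ ht))
    dist_nonneg, UpperHalfPlane.cosh_dist, Complex.dist_eq, Complex.sq_norm, Complex.normSq_apply]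
  congr 1
  simp [UpperHalfPlane.im, sq]

protected theorem dist_triangle (p q s : HyperbolicSpace d) :
    dist p s ≤ dist p q + dist q s := by
  have hp := p.height_pos
  have hq := q.height_pos
  have hs := s.height_pos
  have key := dist_triangle (UpperHalfPlane.mk ⟨0, p.height⟩ hp)
    (UpperHalfPlane.mk ⟨‖p.horiz - q.horiz‖, q.height⟩ hq)
    (UpperHalfPlane.mk ⟨‖p.horiz - q.horiz‖ + ‖q.horiz - s.horiz‖, s.height⟩ hs)
  rw [upperHalfPlane_dist, upperHalfPlane_dist, upperHalfPlane_dist] at key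
  simp only [zero_sub, neg_sq, sub_add_cancel_left] at key
  refine le_trans ?_ key
  rw [dist_def, Real.arcosh_le_arcosh]
  · have h := norm_sub_le_norm_sub_add_norm_sub p.horiz q.horiz s.horiz
    gcongr
  · linarith [frac_nonneg p s]
  · positivity

instance : MetricSpace (HyperbolicSpace d) where
  dist_self p := by simp [dist_def]
  dist_comm p q := by
    rw [dist_def, dist_def, norm_sub_rev]
    ring_nf
  dist_triangle := HyperbolicSpace.dist_triangle
  eq_of_dist_eq_zero {p q} h := by
    have hp := p.height_pos
    have hq := q.height_pos
    have h₀ := frac_nonneg p q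
    rw [dist_def, Real.arcosh_eq_zero_iff (by linarith)] at h
    have h₁ : (‖p.horiz - q.horiz‖ ^ 2 + (p.height - q.height) ^ 2)
        / (2 * p.height * q.height) = 0 := by linarith
    rw [div_eq_zero_iff] at h₁
    have h₂ : ‖p.horiz - q.horiz‖ ^ 2 + (p.height - q.height) ^ 2 = 0 :=
      h₁.resolve_right (by positivity)
    have h₃ : ‖p.horiz - q.horiz‖ = 0 := by
      nlinarith [sq_nonneg ‖p.horiz - q.horiz‖, sq_nonneg (p.height - q.height)]
    have h₄ : p.height - q.height = 0 := by
      nlinarith [sq_nonneg ‖p.horiz - q.horiz‖, sq_nonneg (p.height - q.height)]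
    ext1
    · linarith
    · exact sub_eq_zero.mp (norm_eq_zero.mp h₃)

end HyperbolicSpace

/-- A family of hash functions from `X` to the set `U` of buckets, together with the probability
distribution from which a random member of the family is drawn. The functions are indexed by the
points of a probability space, and for each point of `X` its bucket is a (discrete) random
variable. -/
structure HashFamily (X U : Type) where
  /-- the indices of the hash functions -/
  Ω : Type
  /-- the σ-algebra of events -/
  [mΩ : MeasurableSpace Ω]
  /-- the law of the random index -/
  P : Measure Ω
  /-- the law is a probability measure -/
  [isProb : IsProbabilityMeasure P]
  /-- the hash function with a given index -/
  hash : Ω → X → U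
  /-- the event that a given point falls into a given bucket is measurable -/
  measurableSet_hash : ∀ (x : X) (u : U), MeasurableSet {ω | hash ω x = u}

namespace HashFamily

attribute [instance] HashFamily.mΩ HashFamily.isProb

variable {X U : Type}

/-- The probability that a random hash function of the family maps `x` and `y` to the same
bucket. -/
def collisionProb (H : HashFamily X U) (x y : X) : ℝ :=
  H.P.real {ω | H.hash ω x = H.hash ω y}

/-- `H` is `(r, R, p₁, p₂)`-sensitive: points at distance at most `r` collide with probability at
least `p₁`, points at distance at least `R` collide with probability at most `p₂`. -/
def IsSensitive [MetricSpace X] (H : HashFamily X U) (r R p₁ p₂ : ℝ) : Prop :=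
  ∀ x y : X, (dist x y ≤ r → p₁ ≤ H.collisionProb x y) ∧
    (R ≤ dist x y → H.collisionProb x y ≤ p₂)

end HashFamily

/-- The performance exponent `ρ = log (1 / p₁) / log (1 / p₂)`. -/
def lshExponent (p₁ p₂ : ℝ) : ℝ :=
  Real.log (1 / p₁) / Real.log (1 / p₂)

end

/-!
The measure of the hyperplanes that separate two points of hyperbolic space is a multiple of their
distance (Crofton's formula). For a Poisson process of hyperplanes, two points lie in the same cell
with probability `exp (-measure of the separating hyperplanes)`, so hashing a point to its cell has
exponent `1 / c`. Two simplifications are made.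

* The Poisson process is replaced by independent draws: the invariant measure is a countable sum of
  measures of mass at most `1 - κ`, and at most one hyperplane is drawn from each. This costs a
  factor `κ⁻¹` in the exponent, where `κ < 1` is arbitrary
  (`exists_hashFamily_of_cutMeasure`).
* Hyperplanes are parametrized by vectors of Minkowski space, and the invariant measure is Lebesgue
  measure on the vectors on which the Lorentzian form lies between `0` and `1`. Isometries act by
  linear maps that preserve both, so translations, dilations and the inversion reduce every pair of
  points to one on a fixed vertical geodesic (`sepMeasure_eq_sepProfile`). There the measure is
  additive (`sepMeasure_axis_trans`), and it is finite and positive (`sepProfile_ne_top`,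
  `sepProfile_pos`); additivity and monotonicity give `c g(r) ≤ g(c r)` for the measure `g(t)` of
  the hyperplanes separating points at distance `t` (`mul_toReal_sepProfile_le`).

With `p₁ = exp (-g(r) / κ)` and `p₂ = exp (-g(c r))` the exponent is at most `1 / (κ c)`.
-/

open scoped ENNReal symmDiff

/-! ### Hash families from cut measures -/

section CutMeasure

variable {T : Type} [MeasurableSpace T]

/-- An s-finite measure is a countable sum of measures of arbitrarily small total mass. No
non-atomicity is needed, as the pieces are multiples of one another rather than restrictions to
disjoint sets. -/
theorem MeasureTheory.Measure.exists_eq_sum_le (μ : Measure T) [SFinite μ] {ε : ℝ≥0∞} (hε : ε ≠ 0) :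
    ∃ (ι : Type) (_ : Countable ι) (ν : ι → Measure T),
      μ = Measure.sum ν ∧ ∀ i, ν i Set.univ ≤ ε := by
  have hK : ∀ n, ∃ K : ℕ, K ≠ 0 ∧ (K : ℝ≥0∞)⁻¹ * sfiniteSeq μ n Set.univ ≤ ε := by
    intro n
    obtain ⟨K, hK⟩ := ENNReal.exists_nat_mul_gt hε (measure_ne_top (sfiniteSeq μ n) Set.univ)
    have hK0 : K ≠ 0 := by rintro rfl; simp at hK
    refine ⟨K, hK0, ?_⟩
    rw [mul_comm, ← div_eq_mul_inv]
    exact ENNReal.div_le_of_le_mul (by rw [mul_comm]; exact hK.le)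
  choose K hK0 hK using hK
  refine ⟨Σ n, Fin (K n), inferInstance,
    fun i => (K i.1 : ℝ≥0∞)⁻¹ • sfiniteSeq μ i.1, ?_, fun i => by simpa using hK i.1⟩
  ext s hs
  conv_lhs => rw [← sum_sfiniteSeq μ]
  rw [Measure.sum_apply _ hs, Measure.sum_apply _ hs, ENNReal.tsum_sigma']
  refine tsum_congr fun n => ?_
  simp only [Measure.smul_apply, smul_eq_mul, tsum_fintype, Finset.sum_const, Finset.card_univ,
    Fintype.card_fin, nsmul_eq_mul]
  rw [← mul_assoc, ENNReal.mul_inv_cancel (by simpa using hK0 n) (by simp), one_mul]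

theorem Real.exp_neg_div_le_one_sub {κ a : ℝ} (hκ : 0 < κ) (ha : 0 ≤ a) (haκ : a ≤ 1 - κ) :
    Real.exp (-(a / κ)) ≤ 1 - a := by
  have h1 : 1 + a / κ ≤ Real.exp (a / κ) := by linarith [Real.add_one_le_exp (a / κ)]
  have h2 : 1 ≤ (1 - a) * (1 + a / κ) := by
    have : (1 - a) * (1 + a / κ) = 1 + a * ((1 - κ - a) / κ) := by field_simp; ring
    rw [this]
    have : 0 ≤ (1 - κ - a) / κ := div_nonneg (by linarith) hκ.le
    nlinarith [mul_nonneg ha this]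
  rw [Real.exp_neg, inv_le_iff_one_le_mul₀ (Real.exp_pos _)]
  calc (1 : ℝ) ≤ (1 - a) * (1 + a / κ) := h2
    _ ≤ _ := by gcongr; linarith

/-- An infinite product of factors `1 - a i` with small `a i` is nearly the exponential of
`-∑ i, a i`. -/
theorem ENNReal.tprod_one_sub_mem_Icc {ι : Type} {κ A : ℝ} (hκ : 0 < κ) {a : ι → ℝ}
    (ha0 : ∀ i, 0 ≤ a i) (ha : ∀ i, a i ≤ 1 - κ) (hA : HasSum a A) :
    ∏' i, ENNReal.ofReal (1 - a i) ∈
      Set.Icc (ENNReal.ofReal (Real.exp (-(A / κ)))) (ENNReal.ofReal (Real.exp (-A))) := by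
  have h1 : ∀ i, ENNReal.ofReal (1 - a i) ≤ 1 := fun i => by
    rw [ENNReal.ofReal_le_one]; linarith [ha0 i]
  have hpos : ∀ i, 0 ≤ 1 - a i := fun i => by linarith [ha i]
  rw [ENNReal.tprod_eq_iInf_prod h1]
  constructor
  · refine le_iInf fun s => ?_
    rw [← ENNReal.ofReal_prod_of_nonneg fun i _ => hpos i]
    refine ENNReal.ofReal_le_ofReal ?_
    calc Real.exp (-(A / κ)) ≤ Real.exp (∑ i ∈ s, -(a i / κ)) := by
          rw [Real.exp_le_exp, Finset.sum_neg_distrib, ← Finset.sum_div]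
          gcongr
          exact sum_le_hasSum s (fun i _ => ha0 i) hA
      _ = ∏ i ∈ s, Real.exp (-(a i / κ)) := Real.exp_sum _ _
      _ ≤ _ := Finset.prod_le_prod (fun _ _ => (Real.exp_pos _).le)
          fun i _ => Real.exp_neg_div_le_one_sub hκ (ha0 i) (ha i)
  · have ht : Filter.Tendsto (fun s : Finset ι => ENNReal.ofReal (Real.exp (-∑ i ∈ s, a i)))
        Filter.atTop (nhds (ENNReal.ofReal (Real.exp (-A)))) :=
      ENNReal.tendsto_ofReal ((Real.continuous_exp.tendsto _).comp
        (Filter.Tendsto.neg (l := Filter.atTop) hA))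
    refine ge_of_tendsto' ht fun s => (iInf_le _ s).trans ?_
    rw [← ENNReal.ofReal_prod_of_nonneg fun i _ => hpos i]
    refine ENNReal.ofReal_le_ofReal ?_
    rw [← Finset.sum_neg_distrib, Real.exp_sum]
    exact Finset.prod_le_prod (fun i _ => hpos i)
      fun i _ => by linarith [Real.add_one_le_exp (-a i)]

/-- The law of a single draw from a measure `ν` of mass at most one: a point chosen according to `ν`,
or else, with the remaining probability, the dummy point `t₀`. It is a probability measure only if
`ν Set.univ ≤ 1`, since the subtraction is truncated. -/
noncomputable def drawLaw (ν : Measure T) (t₀ : T) : Measure T :=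
  ν + (1 - ν Set.univ) • Measure.dirac t₀

theorem isProbabilityMeasure_drawLaw {ν : Measure T} (hν : ν Set.univ ≤ 1) (t₀ : T) :
    IsProbabilityMeasure (drawLaw ν t₀) :=
  ⟨by simp [drawLaw, add_tsub_cancel_of_le hν]⟩

theorem drawLaw_apply (ν : Measure T) {t₀ : T} {S : Set T} (hS : MeasurableSet S) (h : t₀ ∉ S) :
    drawLaw ν t₀ S = ν S := by
  simp [drawLaw, Measure.dirac_apply' _ hS, h]

open Classical in
/-- If the points of `X` are represented by sets `E x` of cuts, then the measure of the cuts that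
separate two points determines, up to a factor `κ` arbitrarily close to `1`, the negative logarithm
of a collision probability. From each piece of `μ` of mass at most `1 - κ` at most one cut is drawn,
independently of the other pieces (the dummy `t₀` separates nothing), and the bucket of `x` is the
set of pieces whose cut separates `x` from a base point. By Borel–Cantelli this set is almost surely
finite; the bucket `none` collects the exceptions, so that there are countably many buckets. -/
theorem exists_hashFamily_of_cutMeasure {X : Type} [Nonempty X] (μ : Measure T) [SFinite μ]
    (t₀ : T) (E : X → Set T) (hE : ∀ x, MeasurableSet (E x)) (ht₀ : ∀ x, t₀ ∉ E x)
    (hfin : ∀ x y, μ (E x ∆ E y) ≠ ∞) {κ : ℝ} (hκ0 : 0 < κ) (hκ1 : κ < 1) :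
    ∃ (U : Type) (_ : Countable U) (H : HashFamily X U), ∀ x y,
      Real.exp (-(μ.real (E x ∆ E y) / κ)) ≤ H.collisionProb x y ∧
        H.collisionProb x y ≤ Real.exp (-μ.real (E x ∆ E y)) := by
  obtain ⟨ι, hι, ν, hμ, hν⟩ := μ.exists_eq_sum_le
    (ε := ENNReal.ofReal (1 - κ)) (by simpa using hκ1)
  have hprob : ∀ i, IsProbabilityMeasure (drawLaw (ν i) t₀) := fun i =>
    isProbabilityMeasure_drawLaw ((hν i).trans (by rw [ENNReal.ofReal_le_one]; linarith)) t₀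
  obtain ⟨o⟩ := ‹Nonempty X›
  have hS : ∀ x y, MeasurableSet (E x ∆ E y) := fun x y => (hE x).symmDiff (hE y)
  have ht : ∀ x y, t₀ ∉ E x ∆ E y := fun x y => by simp [Set.mem_symmDiff, ht₀]
  have hsum : ∀ x y, ∑' i, ν i (E x ∆ E y) = μ (E x ∆ E y) := fun x y => by
    rw [hμ, Measure.sum_apply _ (hS x y)]
  let P : Measure (ι → T) := Measure.infinitePi fun i => drawLaw (ν i) t₀
  have hP : IsProbabilityMeasure P := by infer_instance
  -- the set of indices of the drawn cuts that separate `x` from the base point `o`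
  let N : X → (ι → T) → Set ι := fun x ω => {i | ω i ∈ E x ∆ E o}
  let hash : (ι → T) → X → Option (Finset ι) := fun ω x =>
    if h : (N x ω).Finite then some h.toFinset else none
  have hash_some : ∀ ω x u, hash ω x = some u ↔ N x ω = u := by
    intro ω x u
    simp only [hash]
    split_ifs with h
    · rw [Option.some_inj, ← Finset.coe_inj, Set.Finite.coe_toFinset]
    · simp only [false_iff]
      exact fun h' => h (h' ▸ u.finite_toSet)
  have hmeas_some : ∀ x (u : Finset ι), MeasurableSet {ω | hash ω x = some u} := by
    intro x u
    have : {ω | hash ω x = some u} =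
        ⋂ i, if i ∈ u then {ω | ω i ∈ E x ∆ E o} else {ω | ω i ∈ E x ∆ E o}ᶜ := by
      ext ω
      simp only [hash_some, Set.mem_ofPred_eq, Set.mem_iInter, Set.ext_iff, N, Finset.mem_coe]
      refine forall_congr' fun i => ?_
      split_ifs with hi <;> simp [hi]
    rw [this]
    refine MeasurableSet.iInter fun i => ?_
    have := measurable_pi_apply (X := fun _ : ι => T) i (hS x o)
    split_ifs
    exacts [this, this.compl]
  let H : HashFamily X (Option (Finset ι)) :=
    { Ω := ι → T
      P := P
      hash := hash
      measurableSet_hash := by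
        rintro x (_ | u)
        · have : {ω | hash ω x = none} = (⋃ u, {ω | hash ω x = some u})ᶜ := by
            ext ω
            simp [Option.eq_none_iff_forall_ne_some]
          rw [this]
          exact (MeasurableSet.iUnion (hmeas_some x)).compl
        · exact hmeas_some x u }
  refine ⟨Option (Finset ι), inferInstance, H, fun x y => ?_⟩
  have hmarg : ∀ i x, P {ω | ω i ∈ E x ∆ E o} = ν i (E x ∆ E o) := fun i x => by
    rw [← drawLaw_apply (ν i) (hS x o) (ht x o)]
    exact (measurePreserving_eval_infinitePi (fun i => drawLaw (ν i) t₀) i).measure_preimage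
      (hS x o).nullMeasurableSet
  have hNfin : ∀ x, ∀ᵐ ω ∂P, (N x ω).Finite := fun x =>
    ae_finite_setOfPred_mem (s := fun i => {ω : ι → T | ω i ∈ E x ∆ E o})
      (by simp_rw [hmarg, hsum]; exact hfin x o)
  have hcoll : {ω | hash ω x = hash ω y} =ᵐ[P] Set.univ.pi fun _ => (E x ∆ E y)ᶜ := by
    filter_upwards [hNfin x, hNfin y] with ω hx hy
    apply propext
    change hash ω x = hash ω y ↔ ω ∈ Set.univ.pi fun _ => (E x ∆ E y)ᶜ
    simp only [hash]
    rw [dif_pos hx, dif_pos hy, Option.some_inj, Set.Finite.toFinset_inj]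
    simp only [N, Set.ext_iff, Set.mem_univ_pi, Set.mem_ofPred_eq, Set.mem_compl_iff,
      Set.mem_symmDiff]
    exact forall_congr' fun i => by tauto
  have hle : ∀ i, ν i (E x ∆ E y) ≤ ENNReal.ofReal (1 - κ) := fun i =>
    (measure_mono (Set.subset_univ _)).trans (hν i)
  have hne : ∀ i, ν i (E x ∆ E y) ≠ ∞ := fun i => ne_top_of_le_ne_top ENNReal.ofReal_ne_top (hle i)
  have hcompl : ∀ i, drawLaw (ν i) t₀ (E x ∆ E y)ᶜ =
      ENNReal.ofReal (1 - (ν i).real (E x ∆ E y)) := fun i => by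
    rw [prob_compl_eq_one_sub (hS x y), drawLaw_apply _ (hS x y) (ht x y),
      ENNReal.ofReal_sub _ measureReal_nonneg, ENNReal.ofReal_one, ofReal_measureReal (hne i)]
  have hA : HasSum (fun i => (ν i).real (E x ∆ E y)) (μ.real (E x ∆ E y)) := by
    have := ENNReal.hasSum_toReal (f := fun i => ν i (E x ∆ E y))
      (by rw [hsum]; exact hfin x y)
    rwa [← ENNReal.tsum_toReal_eq hne, hsum] at this
  have key := ENNReal.tprod_one_sub_mem_Icc hκ0 (fun i => measureReal_nonneg)
    (fun i => ENNReal.toReal_le_of_le_ofReal (by linarith) (hle i)) hA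
  have hval : P {ω | hash ω x = hash ω y} =
      ∏' i, ENNReal.ofReal (1 - (ν i).real (E x ∆ E y)) := by
    rw [measure_congr hcoll, Measure.infinitePi_pi_univ _ fun _ => (hS x y).compl]
    exact tprod_congr hcompl
  rw [← hval] at key
  refine ⟨?_, ?_⟩
  · exact (ENNReal.ofReal_le_iff_le_toReal (measure_ne_top _ _)).1 key.1
  · exact ENNReal.toReal_le_of_le_ofReal (Real.exp_pos _).le key.2

end CutMeasure

/-! ### The invariant measure on hyperplanes -/

namespace HyperbolicSpace

variable {d : ℕ}

/-- The linear parameters `(b, α, β)` of the oriented hyperplanes of hyperbolic space: the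
hyperplane (a hemisphere, or a vertical hyperplane if `α = 0`) is the zero set of
`α (‖x‖² + z²) - 2 ⟪b, x⟫ + β`. A hyperplane is represented by a whole ray of parameters, and
parameters with `‖b‖² ≤ α β` represent no hyperplane. -/
abbrev Cut (d : ℕ) : Type := EuclideanSpace ℝ (Fin (d - 1)) × ℝ × ℝ

/-- The function `α (‖x‖² + z²) - 2 ⟪b, x⟫ + β` on hyperbolic space, whose sign tells the two sides
of the hyperplane with parameters `(b, α, β)` apart. -/
noncomputable def cutForm (v : Cut d) (p : HyperbolicSpace d) : ℝ :=
  v.2.1 * (‖p.horiz‖ ^ 2 + p.height ^ 2) - 2 * inner ℝ v.1 p.horiz + v.2.2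

/-- The Lorentzian quadratic form `‖b‖² - α β`, which is positive exactly if `(b, α, β)` represents
a hyperplane. -/
noncomputable def cutDisc (v : Cut d) : ℝ := ‖v.1‖ ^ 2 - v.2.1 * v.2.2

/-- The hyperplanes that have the point `p` on their positive side. -/
def posCuts (p : HyperbolicSpace d) : Set (Cut d) := {v | 0 < cutForm v p}

/-- The isometry-invariant measure on hyperplanes, up to normalization, as Lebesgue measure on the
parameters `v` with `0 < cutDisc v < 1`. The upper bound truncates the rays of parameters, which
makes the measure of the hyperplanes through a compact set finite; isometries respect it, since
they act on the parameters linearly, preserving the quadratic form. -/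
noncomputable def cutMeasure (d : ℕ) : Measure (Cut d) :=
  volume.restrict {v | 0 < cutDisc v ∧ cutDisc v < 1}

instance : SFinite (cutMeasure d) := by unfold cutMeasure; infer_instance

/-- The measure of the hyperplanes that separate `p` from `q`. -/
noncomputable def sepMeasure (p q : HyperbolicSpace d) : ℝ≥0∞ :=
  cutMeasure d (posCuts p ∆ posCuts q)

theorem continuous_cutForm (p : HyperbolicSpace d) : Continuous fun v : Cut d => cutForm v p := by
  unfold cutForm; fun_prop

theorem continuous_cutDisc : Continuous fun v : Cut d => cutDisc v := by
  unfold cutDisc; fun_prop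

theorem measurableSet_posCuts (p : HyperbolicSpace d) : MeasurableSet (posCuts p) :=
  (isOpen_lt continuous_const (continuous_cutForm p)).measurableSet

theorem isOpen_cutDisc : IsOpen {v : Cut d | 0 < cutDisc v ∧ cutDisc v < 1} :=
  (isOpen_lt continuous_const continuous_cutDisc).inter
    (isOpen_lt continuous_cutDisc continuous_const)

theorem sepMeasure_comm (p q : HyperbolicSpace d) : sepMeasure p q = sepMeasure q p := by
  rw [sepMeasure, symmDiff_comm, sepMeasure]

/-- A measure preserving transformation of the parameters that preserves the quadratic form, and
that moves `cutForm · p` and `cutForm · q` to positive multiples of `cutForm · p'` and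
`cutForm · q'`, preserves the measure of the separating hyperplanes. -/
theorem sepMeasure_eq_of_measurePreserving {τ : Cut d → Cut d} (hτ : MeasurePreserving τ)
    (hdisc : ∀ v, cutDisc (τ v) = cutDisc v) {p q p' q' : HyperbolicSpace d} {a b : ℝ}
    (ha : 0 < a) (hb : 0 < b) (hp : ∀ v, cutForm (τ v) p = a * cutForm v p')
    (hq : ∀ v, cutForm (τ v) q = b * cutForm v q') : sepMeasure p q = sepMeasure p' q' := by
  have h1 : MeasurePreserving τ (cutMeasure d) (cutMeasure d) := by
    have := hτ.restrict_preimage (s := {v | 0 < cutDisc v ∧ cutDisc v < 1})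
      isOpen_cutDisc.measurableSet
    simp only [Set.preimage_ofPred_eq, hdisc] at this
    exact this
  have h2 : τ ⁻¹' (posCuts p ∆ posCuts q) = posCuts p' ∆ posCuts q' := by
    ext v
    simp [posCuts, Set.mem_symmDiff, hp, hq, ha, hb, mul_pos_iff_of_pos_left]
  rw [sepMeasure, sepMeasure, ← h2, h1.measure_preimage
    ((measurableSet_posCuts p).symmDiff (measurableSet_posCuts q)).nullMeasurableSet]

/-! ### Isometries -/

/-- The horizontal translation by `t`, an isometry of hyperbolic space. -/
def translate (t : EuclideanSpace ℝ (Fin (d - 1))) (p : HyperbolicSpace d) : HyperbolicSpace d :=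
  ⟨p.height, p.horiz + t, p.height_pos⟩

theorem dist_translate (t : EuclideanSpace ℝ (Fin (d - 1))) (p q : HyperbolicSpace d) :
    dist (translate t p) (translate t q) = dist p q := by
  simp [dist_def, translate]

/-- The action of a horizontal translation on the parameters, a composition of two shears. -/
theorem measurePreserving_shear (t : EuclideanSpace ℝ (Fin (d - 1))) :
    MeasurePreserving fun v : Cut d =>
      ((v.1 - v.2.1 • t, v.2.1, v.2.2 + (v.2.1 * ‖t‖ ^ 2 - 2 * inner ℝ v.1 t)) : Cut d) := by
  have h1 : MeasurePreserving fun v : Cut d =>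
      ((v.1, v.2.1, v.2.2 + (v.2.1 * ‖t‖ ^ 2 - 2 * inner ℝ v.1 t)) : Cut d) := by
    refine (MeasurePreserving.id (volume : Measure (EuclideanSpace ℝ (Fin (d - 1))))).skew_product
      (g := fun b (w : ℝ × ℝ) => ((w.1, w.2 + (w.1 * ‖t‖ ^ 2 - 2 * inner ℝ b t)) : ℝ × ℝ)) ?_
      (.of_forall fun b => ?_)
    · exact Continuous.measurable (by fun_prop)
    · refine ((MeasurePreserving.id (volume : Measure ℝ)).skew_product
        (g := fun α β => β + (α * ‖t‖ ^ 2 - 2 * inner ℝ b t)) ?_ (.of_forall fun α => ?_)).map_eq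
      · exact Continuous.measurable (by fun_prop)
      · exact map_add_right_eq_self volume _
  have h2 : MeasurePreserving fun v : (ℝ × ℝ) × EuclideanSpace ℝ (Fin (d - 1)) =>
      (v.1, v.2 - v.1.1 • t) := by
    refine (MeasurePreserving.id (volume : Measure (ℝ × ℝ))).skew_product
      (g := fun w b => b - w.1 • t) ?_ (.of_forall fun w => ?_)
    · exact Continuous.measurable (by fun_prop)
    · exact map_sub_right_eq_self volume _
  exact (Measure.measurePreserving_swap.comp (h2.comp Measure.measurePreserving_swap)).comp h1

theorem sepMeasure_translate (t : EuclideanSpace ℝ (Fin (d - 1))) (p q : HyperbolicSpace d) :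
    sepMeasure (translate t p) (translate t q) = sepMeasure p q := by
  symm
  have key : ∀ (v : Cut d) (p : HyperbolicSpace d), cutForm ((v.1 - v.2.1 • t, v.2.1,
      v.2.2 + (v.2.1 * ‖t‖ ^ 2 - 2 * inner ℝ v.1 t)) : Cut d) p =
      1 * cutForm v (translate t p) := fun v p => by
    simp only [cutForm, translate, norm_add_sq_real, inner_sub_left, inner_add_right,
      real_inner_smul_left, real_inner_comm t p.horiz]
    ring
  refine sepMeasure_eq_of_measurePreserving (measurePreserving_shear t) (fun v => ?_)
    one_pos one_pos (fun v => key v p) (fun v => key v q)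
  simp only [cutDisc, norm_sub_sq_real, norm_smul, real_inner_smul_right, mul_pow,
    Real.norm_eq_abs, sq_abs]
  ring

/-- The inversion in the unit sphere, an isometry of hyperbolic space. -/
noncomputable def invert (p : HyperbolicSpace d) : HyperbolicSpace d where
  height := p.height / (‖p.horiz‖ ^ 2 + p.height ^ 2)
  horiz := (‖p.horiz‖ ^ 2 + p.height ^ 2)⁻¹ • p.horiz
  height_pos := by have := p.height_pos; positivity

theorem normSq_pos (p : HyperbolicSpace d) : 0 < ‖p.horiz‖ ^ 2 + p.height ^ 2 := by
  have := p.height_pos; positivity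

theorem normSq_invert (p : HyperbolicSpace d) :
    ‖(invert p).horiz‖ ^ 2 + (invert p).height ^ 2 = (‖p.horiz‖ ^ 2 + p.height ^ 2)⁻¹ := by
  have h := normSq_pos p
  simp only [invert, norm_smul, norm_inv, Real.norm_of_nonneg h.le]
  field_simp

theorem dist_invert (p q : HyperbolicSpace d) : dist (invert p) (invert q) = dist p q := by
  have hp := p.height_pos
  have hq := q.height_pos
  have hP := normSq_pos p
  have hQ := normSq_pos q
  have key : ∀ p q : HyperbolicSpace d, ‖p.horiz - q.horiz‖ ^ 2 + (p.height - q.height) ^ 2 =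
      (‖p.horiz‖ ^ 2 + p.height ^ 2) + (‖q.horiz‖ ^ 2 + q.height ^ 2)
        - 2 * (inner ℝ p.horiz q.horiz + p.height * q.height) := fun p q => by
    rw [norm_sub_sq_real]; ring
  rw [dist_def, dist_def, key, key p q, normSq_invert, normSq_invert]
  congr 2
  simp only [invert, real_inner_smul_left, real_inner_smul_right]
  field_simp
  ring

/-- Invariance under the inversion, which acts on the parameters by swapping `α` and `β`. -/
theorem sepMeasure_invert (p q : HyperbolicSpace d) :
    sepMeasure (invert p) (invert q) = sepMeasure p q := by
  symm
  have hτ : MeasurePreserving fun v : Cut d => ((v.1, v.2.2, v.2.1) : Cut d) :=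
    (MeasurePreserving.id volume).prod Measure.measurePreserving_swap
  have key : ∀ (v : Cut d) (p : HyperbolicSpace d), cutForm ((v.1, v.2.2, v.2.1) : Cut d) p =
      (‖p.horiz‖ ^ 2 + p.height ^ 2) * cutForm v (invert p) := fun v p => by
    have h := normSq_pos p
    rw [cutForm, cutForm, normSq_invert]
    simp only [invert, real_inner_smul_right]
    field_simp
    ring
  exact sepMeasure_eq_of_measurePreserving hτ (fun v => by simp only [cutDisc]; ring)
    (normSq_pos p) (normSq_pos q) (fun v => key v p) (fun v => key v q)

/-- The unit speed parametrization of the vertical geodesic above the origin. -/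
noncomputable def axis (d : ℕ) (t : ℝ) : HyperbolicSpace d := ⟨Real.exp t, 0, Real.exp_pos t⟩

theorem cutForm_axis (v : Cut d) (t : ℝ) :
    cutForm v (axis d t) = v.2.1 * Real.exp t ^ 2 + v.2.2 := by
  simp [cutForm, axis]

theorem dist_axis (s t : ℝ) : dist (axis d s) (axis d t) = |s - t| := by
  rw [dist_def, ← Real.arcosh_cosh (abs_nonneg (s - t)), Real.cosh_abs, Real.cosh_eq,
    Real.exp_neg, Real.exp_sub]
  congr 1
  simp only [axis, sub_self, norm_zero]
  field_simp
  ring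

/-- Invariance under dilations, which act on the parameters by scaling `α` and `β` inversely. -/
theorem sepMeasure_axis_add (s t a : ℝ) :
    sepMeasure (axis d (s + a)) (axis d (t + a)) = sepMeasure (axis d s) (axis d t) := by
  have hpos := Real.exp_pos a
  have hmul : ∀ c : ℝ, 0 < c → Measure.map (c * ·) (volume : Measure ℝ) =
      ENNReal.ofReal c⁻¹ • volume := fun c hc => by
    rw [Real.map_volume_mul_left hc.ne', abs_of_pos (inv_pos.2 hc)]
  have hτ : MeasurePreserving fun v : Cut d =>
      ((v.1, (Real.exp a)⁻¹ * v.2.1, Real.exp a * v.2.2) : Cut d) := by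
    refine (MeasurePreserving.id volume).prod
      (g := fun w : ℝ × ℝ => ((Real.exp a)⁻¹ * w.1, Real.exp a * w.2))
      ⟨Continuous.measurable (by fun_prop), ?_⟩
    change Measure.map (Prod.map ((Real.exp a)⁻¹ * ·) (Real.exp a * ·)) (volume.prod volume) = _
    rw [← Measure.map_prod_map _ _ (by fun_prop) (by fun_prop), hmul _ hpos,
      hmul _ (inv_pos.2 hpos), Measure.prod_smul_left, Measure.prod_smul_right, smul_smul,
      ← ENNReal.ofReal_mul (by positivity), inv_inv, mul_inv_cancel₀ hpos.ne',
      ENNReal.ofReal_one, one_smul]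
    rfl
  have key : ∀ (v : Cut d) (s : ℝ),
      cutForm ((v.1, (Real.exp a)⁻¹ * v.2.1, Real.exp a * v.2.2) : Cut d) (axis d (s + a)) =
        Real.exp a * cutForm v (axis d s) := fun v s => by
    rw [cutForm_axis, cutForm_axis, Real.exp_add]
    field_simp
  refine sepMeasure_eq_of_measurePreserving hτ (fun v => ?_) hpos hpos (fun v => key v s)
    (fun v => key v t)
  simp only [cutDisc]
  field_simp

theorem exists_axis_of_horiz_eq {p q : HyperbolicSpace d} (h : p.horiz = q.horiz) :
    ∃ s t, sepMeasure p q = sepMeasure (axis d s) (axis d t) ∧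
      dist p q = dist (axis d s) (axis d t) := by
  have key : ∀ p' : HyperbolicSpace d, p'.horiz = q.horiz →
      translate (-q.horiz) p' = axis d (Real.log p'.height) := fun p' hp' => by
    ext1
    · simp [translate, axis, Real.exp_log p'.height_pos]
    · simp [translate, axis, hp']
  refine ⟨Real.log p.height, Real.log q.height, ?_, ?_⟩
  · rw [← key p h, ← key q rfl, sepMeasure_translate]
  · rw [← key p h, ← key q rfl, dist_translate]

/-- Two points on no common vertical line can be moved onto one by an isometry: their geodesic is a
semicircle, and an inversion centred at one of its endpoints at infinity straightens it. -/
theorem exists_invert_translate_horiz_eq {p q : HyperbolicSpace d} (h : p.horiz ≠ q.horiz) :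
    ∃ e, (invert (translate e p)).horiz = (invert (translate e q)).horiz := by
  set u := q.horiz - p.horiz with hu
  have hL : 0 < ‖u‖ ^ 2 := by
    have : 0 < ‖u‖ := norm_pos_iff.2 (sub_ne_zero.2 h.symm)
    positivity
  have hz := p.height_pos
  have hw := q.height_pos
  -- the endpoint is `p.horiz + s • u` with a root `s` of this quadratic equation
  obtain ⟨s, hs⟩ : ∃ s : ℝ, ‖u‖ ^ 2 * (s * s) + (-(‖u‖ ^ 2 + q.height ^ 2 - p.height ^ 2)) * s
      + (-p.height ^ 2) = 0 := by
    refine exists_quadratic_eq_zero hL.ne' ⟨√(discrim _ _ _), (Real.mul_self_sqrt ?_).symm⟩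
    rw [discrim]
    nlinarith [sq_nonneg (-(‖u‖ ^ 2 + q.height ^ 2 - p.height ^ 2)), mul_pos hL (pow_pos hz 2)]
  have hP := normSq_pos (translate (-(p.horiz + s • u)) p)
  have hQ := normSq_pos (translate (-(p.horiz + s • u)) q)
  have hx : p.horiz + -(p.horiz + s • u) = (-s) • u := by module
  have hy : q.horiz + -(p.horiz + s • u) = (1 - s) • u := by rw [hu]; module
  refine ⟨-(p.horiz + s • u), ?_⟩
  simp only [invert, translate, hx, hy, norm_smul, mul_pow, Real.norm_eq_abs, sq_abs,
    smul_smul] at hP hQ ⊢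
  congr 1
  field_simp
  linarith

/-- Every pair of points is moved onto the vertical geodesic above the origin by an isometry. -/
theorem exists_axis (p q : HyperbolicSpace d) :
    ∃ s t, sepMeasure p q = sepMeasure (axis d s) (axis d t) ∧
      dist p q = dist (axis d s) (axis d t) := by
  by_cases h : p.horiz = q.horiz
  · exact exists_axis_of_horiz_eq h
  · obtain ⟨e, he⟩ := exists_invert_translate_horiz_eq h
    obtain ⟨s, t, h1, h2⟩ := exists_axis_of_horiz_eq he
    exact ⟨s, t, by rw [← h1, sepMeasure_invert, sepMeasure_translate],
      by rw [← h2, dist_invert, dist_translate]⟩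

/-! ### The separation measure as a function of the distance -/

/-- The measure of the hyperplanes separating two points at distance `t` (for `t ≥ 0`), taken on the
vertical geodesic above the origin. -/
noncomputable def sepProfile (d : ℕ) (t : ℝ) : ℝ≥0∞ := sepMeasure (axis d 0) (axis d t)

theorem sepMeasure_eq_sepProfile (p q : HyperbolicSpace d) :
    sepMeasure p q = sepProfile d (dist p q) := by
  obtain ⟨s, t, h1, h2⟩ := exists_axis p q
  rw [h1, h2, dist_axis, sepProfile]
  rcases le_total s t with h | h
  · rw [abs_of_nonpos (by linarith), ← sepMeasure_axis_add 0 (-(s - t)) s]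
    ring_nf
  · rw [abs_of_nonneg (by linarith), ← sepMeasure_axis_add 0 (s - t) t, sepMeasure_comm]
    ring_nf

/-- Separation measures add up along a geodesic, since a hyperplane crosses a geodesic at most
once. -/
theorem sepMeasure_axis_trans {a b c : ℝ} (hab : a ≤ b) (hbc : b ≤ c) :
    sepMeasure (axis d a) (axis d c) =
      sepMeasure (axis d a) (axis d b) + sepMeasure (axis d b) (axis d c) := by
  have hA : Real.exp a ^ 2 ≤ Real.exp b ^ 2 := by gcongr
  have hB : Real.exp b ^ 2 ≤ Real.exp c ^ 2 := by gcongr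
  -- along the axis, `cutForm` is an affine function of the squared height, hence monotone
  have key : ∀ v : Cut d, (cutForm v (axis d a) ≤ cutForm v (axis d b) ∧
      cutForm v (axis d b) ≤ cutForm v (axis d c)) ∨
      (cutForm v (axis d b) ≤ cutForm v (axis d a) ∧
      cutForm v (axis d c) ≤ cutForm v (axis d b)) := fun v => by
    simp only [cutForm_axis]
    rcases le_total 0 v.2.1 with h | h
    · left
      constructor <;> gcongr
    · right
      constructor <;> nlinarith
  rw [sepMeasure, sepMeasure, sepMeasure, ← measure_union]
  · congr 1
    ext v
    simp only [posCuts, Set.mem_symmDiff, Set.mem_union, Set.mem_ofPred_eq, not_lt]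
    have := key v
    grind
  · rw [Set.disjoint_left]
    intro v
    simp only [posCuts, Set.mem_symmDiff, Set.mem_ofPred_eq, not_lt]
    have := key v
    grind
  · exact (measurableSet_posCuts _).symmDiff (measurableSet_posCuts _)

theorem sepProfile_add {s t : ℝ} (hs : 0 ≤ s) (ht : 0 ≤ t) :
    sepProfile d (s + t) = sepProfile d s + sepProfile d t := by
  have h := sepMeasure_axis_add (d := d) 0 t s
  rw [zero_add, add_comm t s] at h
  rw [sepProfile, sepMeasure_axis_trans hs (le_add_of_nonneg_right ht), h, sepProfile, sepProfile]

theorem sepProfile_mono {s t : ℝ} (hs : 0 ≤ s) (hst : s ≤ t) :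
    sepProfile d s ≤ sepProfile d t := by
  rw [← add_sub_cancel s t, sepProfile_add hs (by linarith)]
  exact le_self_add

theorem sepProfile_nat_mul {t : ℝ} (ht : 0 ≤ t) (n : ℕ) :
    sepProfile d (n * t) = n * sepProfile d t := by
  induction n with
  | zero => simp [sepProfile, sepMeasure]
  | succ n ih =>
    push_cast
    rw [add_mul, one_mul, sepProfile_add (by positivity) ht, ih, add_mul, one_mul]

/-- The parameters with `0 < cutDisc v < 1` of the hyperplanes that separate two given points form a
bounded set. -/
theorem sepProfile_ne_top {t : ℝ} (ht : 0 ≤ t) : sepProfile d t ≠ ∞ := by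
  have hu : 1 ≤ Real.exp t ^ 2 := by
    have := Real.one_le_exp ht
    nlinarith
  set u := Real.exp t ^ 2 with hu_def
  have hsub : (posCuts (axis d 0) ∆ posCuts (axis d t)) ∩
      {v | 0 < cutDisc v ∧ cutDisc v < 1} ⊆ Metric.closedBall 0 (1 + u) := by
    rintro ⟨b, α, β⟩ ⟨h1, h2, h3⟩
    simp only [posCuts, Set.mem_symmDiff, Set.mem_ofPred_eq, not_lt, cutForm_axis, Real.exp_zero,
      ← hu_def, cutDisc] at h1 h2 h3
    have hprod : (α * 1 ^ 2 + β) * (α * u + β) ≤ 0 := by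
      rcases h1 with h | h
      · exact mul_nonpos_of_nonneg_of_nonpos h.1.le h.2
      · exact mul_nonpos_of_nonpos_of_nonneg h.2 h.1.le
    have hαβ : α * β ≤ 0 := by nlinarith [sq_nonneg α, sq_nonneg β]
    have hb : ‖b‖ ^ 2 ≤ 1 := by linarith
    have hαβ' : -1 ≤ α * β := by nlinarith [sq_nonneg ‖b‖]
    have hs : α ^ 2 * u + β ^ 2 ≤ 1 + u := by nlinarith
    rw [mem_closedBall_zero_iff, Prod.norm_def, Prod.norm_def, max_le_iff, max_le_iff]
    refine ⟨?_, ?_, ?_⟩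
    · nlinarith [norm_nonneg b]
    · exact abs_le_of_sq_le_sq (by nlinarith [sq_nonneg α, sq_nonneg β]) (by linarith)
    · exact abs_le_of_sq_le_sq (by nlinarith [sq_nonneg α, sq_nonneg β]) (by linarith)
  rw [sepProfile, sepMeasure, cutMeasure, Measure.restrict_apply
    ((measurableSet_posCuts _).symmDiff (measurableSet_posCuts _))]
  exact ((measure_mono hsub).trans_lt measure_closedBall_lt_top).ne

/-- The parameters with `0 < cutDisc v < 1` of the hyperplanes that strictly separate two given
points form a non-empty open set. -/
theorem sepProfile_pos {t : ℝ} (ht : 0 < t) : 0 < sepProfile d t := by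
  have hu : 1 < Real.exp t ^ 2 := by
    have := Real.one_lt_exp_iff.2 ht
    nlinarith
  set u := Real.exp t ^ 2 with hu_def
  let O : Set (Cut d) := {v | cutForm v (axis d 0) < 0} ∩ {v | 0 < cutForm v (axis d t)} ∩
    {v | 0 < cutDisc v ∧ cutDisc v < 1}
  have hO : IsOpen O := ((isOpen_lt (continuous_cutForm _) continuous_const).inter
    (isOpen_lt continuous_const (continuous_cutForm _))).inter isOpen_cutDisc
  have hne : O.Nonempty := by
    refine ⟨(0, (1 + u)⁻¹, -(1 / 2)), ⟨?_, ?_⟩, ?_, ?_⟩ <;>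
      simp only [Set.mem_ofPred_eq, cutForm_axis, cutDisc, Real.exp_zero, ← hu_def, norm_zero]
    · have : (1 + u)⁻¹ < 2⁻¹ := by gcongr; linarith
      linarith
    · have : (1 + u)⁻¹ * u = 1 - (1 + u)⁻¹ := by field_simp; ring
      have : (1 + u)⁻¹ < 2⁻¹ := by gcongr; linarith
      linarith
    · have : 0 < (1 + u)⁻¹ := by positivity
      linarith
    · have : (1 + u)⁻¹ < 2⁻¹ := by gcongr; linarith
      linarith
  rw [sepProfile, sepMeasure, cutMeasure, Measure.restrict_apply
    ((measurableSet_posCuts _).symmDiff (measurableSet_posCuts _))]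
  refine (hO.measure_pos volume hne).trans_le (measure_mono ?_)
  rintro v ⟨⟨h1, h2⟩, h3⟩
  exact ⟨Or.inr ⟨h2, fun h : 0 < cutForm v (axis d 0) => lt_asymm h h1⟩, h3⟩

/-- Half of the linearity of `sepProfile`: a monotone additive function grows at least linearly. -/
theorem mul_toReal_sepProfile_le {r c : ℝ} (hr : 0 ≤ r) (hc : 0 ≤ c) :
    c * (sepProfile d r).toReal ≤ (sepProfile d (c * r)).toReal := by
  set g := (sepProfile d r).toReal
  have hg : 0 ≤ g := ENNReal.toReal_nonneg
  have key : ∀ n : ℕ, (c * g - (sepProfile d (c * r)).toReal) * n ≤ g := fun n => by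
    have h1 : sepProfile d (⌊n * c⌋₊ * r) ≤ sepProfile d (n * (c * r)) := by
      refine sepProfile_mono (by positivity) ?_
      rw [← mul_assoc]
      gcongr
      exact Nat.floor_le (by positivity)
    rw [sepProfile_nat_mul hr, sepProfile_nat_mul (by positivity)] at h1
    have h2 := ENNReal.toReal_mono
      (ENNReal.mul_ne_top (by simp) (sepProfile_ne_top (by positivity))) h1
    simp only [ENNReal.toReal_mul, ENNReal.toReal_natCast] at h2
    have h3 : (n * c - 1) * g ≤ ⌊n * c⌋₊ * g := by
      gcongr
      linarith [Nat.lt_floor_add_one (n * c)]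
    change (⌊n * c⌋₊ : ℝ) * g ≤ _ at h2
    linarith
  by_contra! hlt
  obtain ⟨n, hn⟩ := exists_nat_gt (g / (c * g - (sepProfile d (c * r)).toReal))
  rw [div_lt_iff₀ (by linarith)] at hn
  linarith [key n]

end HyperbolicSpace

/-! ### The sensitive family -/

open HyperbolicSpace in
/-- Locality sensitive hashing in hyperbolic space of dimension at least three. -/
theorem theorem3 (d : ℕ) (hd : 3 ≤ d) (r c : ℝ) (hr : 0 < r) (hc : 1 < c) :
    ∃ (U : Type) (_ : Countable U) (H : HashFamily (HyperbolicSpace d) U) (p₁ p₂ : ℝ),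
      0 < p₂ ∧ p₂ < p₁ ∧ p₁ < 1 ∧
      H.IsSensitive r (c * r) p₁ p₂ ∧
      lshExponent p₁ p₂ ≤ 1.59 / c := by
  have hc0 : 0 < c := by linarith
  -- `c⁻¹ < κ` will give `p₂ < p₁`, and `100 / 159 < κ` the bound on the exponent
  obtain ⟨κ, hκ, hκ1⟩ : ∃ κ, max c⁻¹ (100 / 159) < κ ∧ κ < 1 :=
    exists_between (max_lt (inv_lt_one_of_one_lt₀ hc) (by norm_num))
  obtain ⟨hκc, hκ159⟩ := max_lt_iff.1 hκ
  have hκ0 : 0 < κ := by linarith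
  have hκc' : 1 < κ * c := by rwa [inv_lt_iff_one_lt_mul₀ hc0] at hκc
  have : Nonempty (HyperbolicSpace d) := ⟨axis d 0⟩
  obtain ⟨U, hU, H, hH⟩ := exists_hashFamily_of_cutMeasure (cutMeasure d) 0
    (posCuts (d := d)) measurableSet_posCuts (fun p => by simp [posCuts, cutForm])
    (fun p q => by
      change sepMeasure p q ≠ ∞
      rw [sepMeasure_eq_sepProfile]
      exact sepProfile_ne_top dist_nonneg) hκ0 hκ1
  have hreal : ∀ p q : HyperbolicSpace d,
      (cutMeasure d).real (posCuts p ∆ posCuts q) = (sepProfile d (dist p q)).toReal :=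
    fun p q => by rw [← sepMeasure_eq_sepProfile]; rfl
  simp only [hreal] at hH
  have hG : c * (sepProfile d r).toReal ≤ (sepProfile d (c * r)).toReal :=
    mul_toReal_sepProfile_le hr.le hc0.le
  have hg : 0 < (sepProfile d r).toReal :=
    ENNReal.toReal_pos (sepProfile_pos hr).ne' (sepProfile_ne_top hr.le)
  have hmono : ∀ {s t : ℝ}, 0 ≤ s → s ≤ t → (sepProfile d s).toReal ≤ (sepProfile d t).toReal :=
    fun hs hst => ENNReal.toReal_mono (sepProfile_ne_top (hs.trans hst)) (sepProfile_mono hs hst)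
  set g := (sepProfile d r).toReal
  set G := (sepProfile d (c * r)).toReal
  have hG0 : 0 < G := lt_of_lt_of_le (by positivity) hG
  have hκG : κ * c * g ≤ κ * G := by rw [mul_assoc]; gcongr
  refine ⟨U, hU, H, Real.exp (-(g / κ)), Real.exp (-G), Real.exp_pos _, ?_, ?_, ?_, ?_⟩
  · rw [Real.exp_lt_exp, neg_lt_neg_iff, div_lt_iff₀ hκ0]
    nlinarith
  · rw [Real.exp_lt_one_iff, neg_lt_zero]
    positivity
  · refine fun p q => ⟨fun h => le_trans ?_ (hH p q).1, fun h => (hH p q).2.trans ?_⟩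
    · rw [Real.exp_le_exp, neg_le_neg_iff]
      gcongr
      exact hmono dist_nonneg h
    · rw [Real.exp_le_exp, neg_le_neg_iff]
      exact hmono (by positivity) h
  · rw [lshExponent, one_div, one_div, ← Real.exp_neg, ← Real.exp_neg, Real.log_exp, Real.log_exp,
      neg_neg, neg_neg, div_div, div_le_div_iff₀ (by positivity) hc0]
    nlinarith
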